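/- Let $A_1,\dots,A_m,B$ be real symmetric $n\times n$ matrices and $c\in\mathbb R^m$. Write $S\bullet T=\operatorname{tr}(ST)$, let $\mathcal S^n_+$ be the cone of symmetric positive semidefinite $n\times n$ matrices, and consider $$(P)\ \ \sup\Big\{c^Tx : B-\sum_{i=1}^m x_iA_i\succeq 0\Big\},\qquad (D)\ \ \inf\{B\bullet Y : A_i\bullet Y=c_i\ (i=1,\dots,m),\ Y\succeq 0\},$$ $$(HD)\ \ A_i\bullet Y=0\ (i=1,\dots,m),\quad B\bullet Y=0,\quad Y\succeq 0 .$$ A slack matrix of $(P)$ is a matrix $Z=B-\sum_i x_iA_i\succeq 0$ with $x\in\mathbb R^m$. Assume that $(P)$ is feasible, that $B,A_1,\dots,A_m$ are linearly independent, that $B=\begin{pmatrix} I_r&0\\0&0\end{pmatrix}$ with $0\le r<n$, and that $B$ is a slack matrix of maximum rank. For an affine subspace $H$ of the symmetric matrices with $H\cap\mathcal S^n_+\neq\emptyset$, the minimal cone of $H\cap \mathcal S^n_+$ is the smallest face of $\mathcal S^n_+$ containing it. Facial reduction starts with $F_0=\mathcal S^n_+$ and in step $i\ge 1$ chooses $Y_i\in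 F_{i-1}^*\cap H^\perp$ and puts $F_i=F_{i-1}\cap Y_i^\perp$, where dual cones and orthogonal complements are taken in the space of symmetric matrices with respect to $\bullet$. The singularity degree of $H\cap\mathcal S^n_+$ is the smallest $k\ge 0$ such that $F_k$ equals the minimal cone for some choice of $Y_1,\dots,Y_k$. The singularity degrees $d(D)$ and $d(HD)$ are those of the feasible sets of $(D)$ and $(HD)$, with $H$ given by the linear equations of the respective system. **Theorem.** Suppose $d(HD)=m+1$. Then $x=0$ is the only feasible solution of $(P)$, and $(D)$ is strictly feasible, i.e. it has a positive definite feasible solution. Hence $\operatorname{val}(P)=\operatorname{val}(D)=0$. Moreover $d(D)=0$. -/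

import Mathlib

open Matrix

namespace SDPDuality

/-- The product `S • T` of square matrices: the trace of their usual product. -/
def bullet {n : ℕ} (S T : Matrix (Fin n) (Fin n) ℝ) : ℝ := (S * T).trace

/-- The cone of real symmetric positive semidefinite matrices of order `n`. -/
def psdCone (n : ℕ) : Set (Matrix (Fin n) (Fin n) ℝ) := {Y | Y.PosSemidef}

/-- The dual cone of a set of symmetric matrices, inside the space of symmetric matrices. -/
def dualCone {n : ℕ} (F : Set (Matrix (Fin n) (Fin n) ℝ)) : Set (Matrix (Fin n) (Fin n) ℝ) :=
  {Y | Y.IsSymm ∧ ∀ X ∈ F, 0 ≤ bullet Y X}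

/-- The orthogonal complement of a set of symmetric matrices, inside the space of symmetric
matrices. -/
def perp {n : ℕ} (H : Set (Matrix (Fin n) (Fin n) ℝ)) : Set (Matrix (Fin n) (Fin n) ℝ) :=
  {Y | Y.IsSymm ∧ ∀ X ∈ H, bullet Y X = 0}

/-- `F` is a face of the convex cone `K`. -/
def IsFace {n : ℕ} (K F : Set (Matrix (Fin n) (Fin n) ℝ)) : Prop :=
  F ⊆ K ∧ Convex ℝ F ∧ ∀ X ∈ K, ∀ Y ∈ K, (1 / 2 : ℝ) • (X + Y) ∈ F → X ∈ F ∧ Y ∈ F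

/-- The minimal cone of `H ∩ K`: the smallest face of `K` that contains `H ∩ K`, see
`isLeast_minimalCone`. -/
def minimalCone {n : ℕ} (H K : Set (Matrix (Fin n) (Fin n) ℝ)) :
    Set (Matrix (Fin n) (Fin n) ℝ) :=
  ⋂₀ {F | IsFace K F ∧ H ∩ K ⊆ F}

theorem isLeast_minimalCone {n : ℕ} (H K : Set (Matrix (Fin n) (Fin n) ℝ)) (hK : Convex ℝ K) :
    IsLeast {F | IsFace K F ∧ H ∩ K ⊆ F} (minimalCone H K) := by
  refine ⟨⟨⟨?_, ?_, ?_⟩, ?_⟩, fun F hF => Set.sInter_subset_of_mem hF⟩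
  · exact Set.sInter_subset_of_mem
      ⟨⟨subset_rfl, hK, fun X hX Y hY _ => ⟨hX, hY⟩⟩, Set.inter_subset_right⟩
  · exact convex_sInter fun F hF => hF.1.2.1
  · intro X hX Y hY h
    exact ⟨fun F hF => (hF.1.2.2 X hX Y hY (h F hF)).1,
      fun F hF => (hF.1.2.2 X hX Y hY (h F hF)).2⟩
  · exact Set.subset_sInter fun F hF => hF.2

/-- The sets produced by facial reduction along `y 0, y 1, …`: start with `K`, and in each step
intersect with the orthogonal complement of the next element. -/
def reducedFace {n : ℕ} (K : Set (Matrix (Fin n) (Fin n) ℝ))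
    (y : ℕ → Matrix (Fin n) (Fin n) ℝ) : ℕ → Set (Matrix (Fin n) (Fin n) ℝ)
  | 0 => K
  | i + 1 => {X | X ∈ reducedFace K y i ∧ bullet (y i) X = 0}

/-- `y 0, …, y (k - 1)` is a possible output of `k` steps of the facial reduction algorithm for
`H ∩ K` (the later terms of `y` play no role). -/
def IsFacialReduction {n : ℕ} (H K : Set (Matrix (Fin n) (Fin n) ℝ)) (k : ℕ)
    (y : ℕ → Matrix (Fin n) (Fin n) ℝ) : Prop :=
  ∀ i < k, y i ∈ dualCone (reducedFace K y i) ∩ perp H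

/-- The singularity degree of `H ∩ K`, for an affine subspace `H` of the symmetric matrices that
meets the closed convex cone `K`: the least number of facial reduction steps that construct the
minimal cone (it would be `⊤` if no number of steps did). -/
noncomputable def singularityDegree {n : ℕ} (H K : Set (Matrix (Fin n) (Fin n) ℝ)) : ℕ∞ :=
  sInf {d | ∃ (k : ℕ) (y : ℕ → Matrix (Fin n) (Fin n) ℝ), d = (k : ℕ∞) ∧
    IsFacialReduction H K k y ∧ reducedFace K y k = minimalCone H K}

end SDPDuality

/-- The data `A₁, …, Aₘ`, `B`, `c` of the semidefinite program
`(P)`: `sup cᵀx` subject to `B - ∑ xᵢ Aᵢ` being positive semidefinite. -/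
structure SDP (m n : ℕ) where
  A : Fin m → Matrix (Fin n) (Fin n) ℝ
  B : Matrix (Fin n) (Fin n) ℝ
  c : Fin m → ℝ
  symm_A : ∀ i, (A i).IsSymm
  symm_B : B.IsSymm

namespace SDP

open SDPDuality

variable {m n : ℕ}

/-- The feasible set of `(P)`. -/
def feasP (S : SDP m n) : Set (Fin m → ℝ) :=
  {x | (S.B - ∑ i, x i • S.A i).PosSemidef}

/-- The feasible set of the dual `(D)`. -/
def feasD (S : SDP m n) : Set (Matrix (Fin n) (Fin n) ℝ) :=
  {Y | (∀ i, bullet (S.A i) Y = S.c i) ∧ Y.PosSemidef}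

/-- The optimal value of `(P)`. -/
noncomputable def valP (S : SDP m n) : EReal := ⨆ x ∈ S.feasP, ((S.c ⬝ᵥ x : ℝ) : EReal)

/-- The optimal value of `(D)`. -/
noncomputable def valD (S : SDP m n) : EReal := ⨅ Y ∈ S.feasD, ((bullet S.B Y : ℝ) : EReal)

/-- `(D)` is strictly feasible. -/
def StrictlyFeasibleD (S : SDP m n) : Prop := ∃ Y ∈ S.feasD, Y.PosDef

/-- The affine subspace of symmetric matrices given by the equations of `(D)`. -/
def affD (S : SDP m n) : Set (Matrix (Fin n) (Fin n) ℝ) :=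
  {Y | Y.IsSymm ∧ ∀ i, bullet (S.A i) Y = S.c i}

/-- The subspace of symmetric matrices given by the equations of the homogeneous dual `(HD)`:
`Aᵢ • Y = 0` for all `i`, `B • Y = 0`, with `Y` positive semidefinite. -/
def linHD (S : SDP m n) : Set (Matrix (Fin n) (Fin n) ℝ) :=
  {Y | Y.IsSymm ∧ (∀ i, bullet (S.A i) Y = 0) ∧ bullet S.B Y = 0}

/-- The singularity degree of `(D)`. -/
noncomputable def singDegD (S : SDP m n) : ℕ∞ := singularityDegree S.affD (psdCone n)

/-- The singularity degree of `(HD)`. -/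
noncomputable def singDegHD (S : SDP m n) : ℕ∞ := singularityDegree S.linHD (psdCone n)

/-- `Z` is a slack matrix in `(P)`. -/
def IsSlack (S : SDP m n) (Z : Matrix (Fin n) (Fin n) ℝ) : Prop :=
  Z.PosSemidef ∧ ∃ x : Fin m → ℝ, Z = S.B - ∑ i, x i • S.A i

/-- The standing assumption on `(P)`: it is feasible, `B, A₁, …, Aₘ` are linearly independent,
`B` is the block diagonal matrix with blocks `I_r` and `0`, where `0 ≤ r < n`, and `B` is a slack
matrix of maximum rank. -/
structure Standard (S : SDP m n) : Prop where
  feasible : S.feasP.Nonempty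
  linearIndependent :
    LinearIndependent ℝ (Fin.cons S.B S.A : Fin (m + 1) → Matrix (Fin n) (Fin n) ℝ)
  form_B : ∃ r < n, S.B = Matrix.diagonal fun i : Fin n => if (i : ℕ) < r then (1 : ℝ) else 0
  isSlack_B : S.IsSlack S.B
  rank_le : ∀ Z, S.IsSlack Z → Z.rank ≤ S.B.rank

end SDP

/-!
Let `L` be the span of `B, A₁, …, Aₘ`, of dimension `m + 1`. Everything follows from one fact
(`SDP.Standard.eq_zero_of_posSemidef`): if `d(HD) = m + 1`, the positive semidefinite matrices in
`L` are only the nonnegative multiples of `B`.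

To see this, consider for a reduced face `F` the subspace of those elements of `L` that are
orthogonal to `F`. If `F` is not yet the minimal cone of `(HD)`, then some element of `L` is
nonnegative, but not zero, on `F` (`SDPDuality.exists_reducing_of_not_subset`), and reducing along
it enlarges this subspace. So the number of steps still needed is at most the codimension of the
subspace in `L` (`SDPDuality.singularityDegree_le_add`). Start the reduction with `B`. As `B` is a
slack matrix of maximum rank, every positive semidefinite `Z` in `L` satisfies `ker B ⊆ ker Z`, and
therefore vanishes on the face orthogonal to `B`. If some such `Z` were not a multiple of `B`, the
subspace would have dimension at least two after one step, and `m` steps would suffice.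

The fact says that a slack matrix of `(P)` can only be `B`, so that `x = 0`. The claims on `(D)`
come from it through the principle that a convex cone in a finite-dimensional space with trivial
dual is the whole space (`SDPDuality.eq_top_of_forall_dual_eq_zero`). Applied to the cone of all
`(Aᵢ • Y)ᵢ` it gives a positive definite solution, and applied to a homogenization of `(D)` with
the objective bounded by `ε` it gives solutions of value below `ε`. A positive definite solution
lies in no proper face, so that `d(D) = 0`.
-/

/-! ### Convex cones in finite dimension -/

namespace SDPDuality

variable {E : Type*} [NormedAddCommGroup E] [NormedSpace ℝ E] [FiniteDimensional ℝ E]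

/-- In finite dimension a convex cone with trivial dual is the whole space, even if it is not
assumed to be closed. -/
theorem eq_top_of_forall_dual_eq_zero (C : ConvexCone ℝ E) (h0 : C.Pointed)
    (h : ∀ f : Module.Dual ℝ E, (∀ x ∈ C, 0 ≤ f x) → f = 0) : C = ⊤ := by
  have hspan : Submodule.span ℝ (C : Set E) = ⊤ := by
    by_contra hne
    obtain ⟨f, hf0, hf⟩ := Submodule.exists_le_ker_of_lt_top _ (lt_top_iff_ne_top.2 hne)
    exact hf0 (h f fun x hx => (LinearMap.mem_ker.1 (hf (Submodule.subset_span hx))).ge)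
  have hint : (interior (C : Set E)).Nonempty := by
    rw [C.convex.interior_nonempty_iff_affineSpan_eq_top]
    have hins : insert (0 : E) (C : Set E) = C := Set.insert_eq_of_mem h0
    apply SetLike.coe_injective
    rw [← hins, affineSpan_insert_zero, hspan]
    rfl
  by_cases h0i : (0 : E) ∈ interior (C : Set E)
  · -- A neighbourhood of the origin absorbs every vector.
    refine eq_top_iff.2 fun x _ => ?_
    have hx := absorbent_nhds_zero (𝕜 := ℝ) (mem_interior_iff_mem_nhds.1 h0i) x
    obtain ⟨r, hr, hrx⟩ := hx.exists_pos
    have := hrx r (by simp [abs_of_pos hr]) rfl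
    rw [Set.mem_smul_set_iff_inv_smul_mem₀ hr.ne'] at this
    exact (C.smul_mem_iff (inv_pos.2 hr)).1 this
  · obtain ⟨f, hf0, hf⟩ :=
      geometric_hahn_banach_of_nonempty_interior_point C.convex h0i hint
    refine absurd (h (-(f : E →ₗ[ℝ] ℝ)) fun x hx => ?_) ?_
    · simpa using hf x hx
    · intro hneg
      apply hf0
      ext x
      simpa using congrArg (fun g : Module.Dual ℝ E => g x) hneg

/-- A convex cone in finite dimension on which every functional that is nonnegative on it vanishes
is closed under negation: inside its linear span it has trivial dual. -/
theorem neg_mem_of_forall_dual_eq_zero_on (C : ConvexCone ℝ E) (h0 : C.Pointed)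
    (h : ∀ f : Module.Dual ℝ E, (∀ x ∈ C, 0 ≤ f x) → ∀ x ∈ C, f x = 0) {x : E} (hx : x ∈ C) :
    -x ∈ C := by
  let W := Submodule.span ℝ (C : Set E)
  have htop : C.comap W.subtype = ⊤ := by
    refine eq_top_of_forall_dual_eq_zero _ ?_ fun f hf => ?_
    · change ((0 : W) : E) ∈ C
      exact h0
    · obtain ⟨g, hg⟩ := f.exists_extend
      have hgf : ∀ w : W, g w = f w := fun w => congrArg (fun k : W →ₗ[ℝ] ℝ => k w) hg
      have hgC := h g fun y hy => by
        have := hf ⟨y, Submodule.subset_span hy⟩ hy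
        rwa [← hgf] at this
      ext w
      rw [← hgf]
      have : W ≤ LinearMap.ker g := Submodule.span_le.2 hgC
      exact this w.2
  have : (-⟨x, Submodule.subset_span hx⟩ : W) ∈ C.comap W.subtype := htop ▸ Set.mem_univ _
  exact this

theorem dual_apply_eq_dotProduct {ι : Type*} [Fintype ι] [DecidableEq ι]
    (f : Module.Dual ℝ (ι → ℝ)) (x : ι → ℝ) :
    f x = (fun i => f (Pi.single i 1)) ⬝ᵥ x := by
  rw [LinearMap.pi_apply_eq_sum_univ f x]
  simp only [dotProduct, smul_eq_mul, mul_comm]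
  refine Finset.sum_congr rfl fun i _ => ?_
  congr 2
  ext j
  simp [Pi.single_apply, eq_comm]

/-! ### Positive semidefinite matrices and the trace product -/

variable {n : ℕ}

theorem isSymm_of_posSemidef {X : Matrix (Fin n) (Fin n) ℝ} (hX : X.PosSemidef) : X.IsSymm := by
  have := hX.isHermitian
  rwa [IsHermitian, conjTranspose_eq_transpose_of_trivial] at this

theorem exists_conjTranspose_mul_self {X : Matrix (Fin n) (Fin n) ℝ} (hX : X.PosSemidef) :
    ∃ C : Matrix (Fin n) (Fin n) ℝ, X = Cᴴ * C := by
  open scoped MatrixOrder Matrix.Norms.L2Operator in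
  exact CStarAlgebra.nonneg_iff_eq_star_mul_self.mp hX.nonneg

theorem bullet_conjTranspose_mul_self (C D : Matrix (Fin n) (Fin n) ℝ) :
    bullet (Cᴴ * C) (Dᴴ * D) = ((C * Dᴴ)ᴴ * (C * Dᴴ)).trace := by
  rw [bullet, ← mul_assoc, trace_mul_comm, conjTranspose_mul, conjTranspose_conjTranspose]
  simp only [mul_assoc]

theorem bullet_nonneg {X Y : Matrix (Fin n) (Fin n) ℝ} (hX : X.PosSemidef)
    (hY : Y.PosSemidef) : 0 ≤ bullet X Y := by
  obtain ⟨C, rfl⟩ := exists_conjTranspose_mul_self hX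
  obtain ⟨D, rfl⟩ := exists_conjTranspose_mul_self hY
  rw [bullet_conjTranspose_mul_self]
  exact (posSemidef_conjTranspose_mul_self _).trace_nonneg

theorem mul_eq_zero_of_bullet_eq_zero {X Y : Matrix (Fin n) (Fin n) ℝ} (hX : X.PosSemidef)
    (hY : Y.PosSemidef) (h : bullet X Y = 0) : X * Y = 0 := by
  obtain ⟨C, rfl⟩ := exists_conjTranspose_mul_self hX
  obtain ⟨D, rfl⟩ := exists_conjTranspose_mul_self hY
  rw [bullet_conjTranspose_mul_self, trace_conjTranspose_mul_self_eq_zero_iff] at h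
  rw [mul_assoc, ← mul_assoc C, h, zero_mul, mul_zero]

theorem bullet_vecMulVec (X : Matrix (Fin n) (Fin n) ℝ) (v : Fin n → ℝ) :
    bullet X (vecMulVec v v) = v ⬝ᵥ X *ᵥ v := by
  rw [bullet, mul_vecMulVec, trace_vecMulVec, dotProduct_comm]

theorem posSemidef_of_bullet_nonneg {X : Matrix (Fin n) (Fin n) ℝ} (hX : X.IsSymm)
    (h : ∀ Y : Matrix (Fin n) (Fin n) ℝ, Y.PosSemidef → 0 ≤ bullet X Y) : X.PosSemidef := by
  refine PosSemidef.of_dotProduct_mulVec_nonneg ?_ fun v => ?_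
  · rwa [IsHermitian, conjTranspose_eq_transpose_of_trivial]
  · have := h (vecMulVec v v) (by simpa using posSemidef_vecMulVec_self_star v)
    rwa [bullet_vecMulVec] at this

/-- A symmetric matrix is dominated by a nonnegative multiple of the identity. -/
theorem exists_smul_one_sub_posSemidef {X : Matrix (Fin n) (Fin n) ℝ} (hX : X.IsSymm) :
    ∃ t : ℝ, 0 ≤ t ∧ (t • (1 : Matrix (Fin n) (Fin n) ℝ) - X).PosSemidef := by
  refine ⟨∑ i, ∑ j, |X i j|, Finset.sum_nonneg fun i _ => Finset.sum_nonneg fun j _ =>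
    abs_nonneg _, PosSemidef.of_dotProduct_mulVec_nonneg ?_ fun v => ?_⟩
  · rw [IsHermitian, conjTranspose_eq_transpose_of_trivial, transpose_sub, transpose_smul,
      transpose_one, hX]
  · have hv : ∀ i, v i * v i ≤ v ⬝ᵥ v := fun i =>
      Finset.single_le_sum (f := fun i => v i * v i) (fun j _ => mul_self_nonneg _)
        (Finset.mem_univ i)
    have key : v ⬝ᵥ X *ᵥ v ≤ (∑ i, ∑ j, |X i j|) * (v ⬝ᵥ v) := by
      have hvXv : v ⬝ᵥ X *ᵥ v = ∑ i, ∑ j, v i * (X i j * v j) := by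
        simp only [dotProduct, mulVec, Finset.mul_sum]
      rw [hvXv, Finset.sum_mul]
      refine Finset.sum_le_sum fun i _ => ?_
      rw [Finset.sum_mul]
      refine Finset.sum_le_sum fun j _ => ?_
      have hij : |v i * v j| ≤ v ⬝ᵥ v :=
        abs_le.2 ⟨by nlinarith [hv i, hv j, sq_nonneg (v i + v j)],
          by nlinarith [hv i, hv j, sq_nonneg (v i - v j)]⟩
      calc v i * (X i j * v j) ≤ |X i j * (v i * v j)| := by
            rw [mul_left_comm]; exact le_abs_self _
        _ ≤ |X i j| * (v ⬝ᵥ v) := by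
            rw [abs_mul]; exact mul_le_mul_of_nonneg_left hij (abs_nonneg _)
    rw [star_trivial, sub_mulVec, smul_mulVec, one_mulVec, dotProduct_sub, dotProduct_smul,
      smul_eq_mul]
    linarith

end SDPDuality

/-! ### The pairing with a family of matrices -/

namespace SDPDuality

variable {n : ℕ} {ι : Type*}

theorem smul_mem_psdCone {X : Matrix (Fin n) (Fin n) ℝ} (hX : X ∈ psdCone n) {t : ℝ}
    (ht : 0 ≤ t) : t • X ∈ psdCone n :=
  PosSemidef.smul hX ht

theorem convex_psdCone (n : ℕ) : Convex ℝ (psdCone n) := fun _ hX _ hY _ _ ha hb _ =>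
  PosSemidef.add (smul_mem_psdCone hX ha) (smul_mem_psdCone hY hb)

/-- The linear map `X ↦ (G j • X)ⱼ` attached to a family of matrices `G j`. -/
def pairing (G : ι → Matrix (Fin n) (Fin n) ℝ) : Matrix (Fin n) (Fin n) ℝ →ₗ[ℝ] (ι → ℝ) where
  toFun X j := bullet (G j) X
  map_add' X Y := by ext j; simp [bullet, mul_add]
  map_smul' t X := by ext j; simp [bullet]

theorem pairing_apply (G : ι → Matrix (Fin n) (Fin n) ℝ) (X : Matrix (Fin n) (Fin n) ℝ) (j : ι) :
    pairing G X j = bullet (G j) X := rfl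

theorem bullet_add (Y X X' : Matrix (Fin n) (Fin n) ℝ) :
    bullet Y (X + X') = bullet Y X + bullet Y X' := by
  simp [bullet, mul_add]

theorem bullet_smul (Y X : Matrix (Fin n) (Fin n) ℝ) (t : ℝ) :
    bullet Y (t • X) = t * bullet Y X := by
  simp [bullet]

variable [Fintype ι]

theorem bullet_sum_smul (G : ι → Matrix (Fin n) (Fin n) ℝ) (w : ι → ℝ)
    (X : Matrix (Fin n) (Fin n) ℝ) : bullet (∑ j, w j • G j) X = w ⬝ᵥ pairing G X := by
  simp [bullet, Finset.sum_mul, trace_sum, dotProduct, pairing_apply]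

theorem isSymm_sum_smul {G : ι → Matrix (Fin n) (Fin n) ℝ} (hG : ∀ j, (G j).IsSymm)
    (w : ι → ℝ) : (∑ j, w j • G j).IsSymm := by
  rw [IsSymm, transpose_sum]
  exact Finset.sum_congr rfl fun j _ => by rw [transpose_smul, hG j]

/-- The linear subspace of symmetric matrices cut out by the equations `G j • Y = 0`. -/
def orthSpace (G : ι → Matrix (Fin n) (Fin n) ℝ) : Set (Matrix (Fin n) (Fin n) ℝ) :=
  {Y | Y.IsSymm ∧ ∀ j, bullet (G j) Y = 0}

theorem sum_smul_mem_perp_orthSpace {G : ι → Matrix (Fin n) (Fin n) ℝ}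
    (hG : ∀ j, (G j).IsSymm) (w : ι → ℝ) : ∑ j, w j • G j ∈ perp (orthSpace G) := by
  refine ⟨isSymm_sum_smul hG w, fun X hX => ?_⟩
  rw [bullet_sum_smul, show pairing G X = 0 from funext hX.2, dotProduct_zero]

/-! ### Faces of the semidefinite cone -/

/-- Writing `Y` as the midpoint of `0` and `2 • Y` shows that a face contains both. -/
theorem IsFace.two_pow_smul_mem {F : Set (Matrix (Fin n) (Fin n) ℝ)} (hF : IsFace (psdCone n) F)
    {X : Matrix (Fin n) (Fin n) ℝ} (hX : X ∈ F) (k : ℕ) :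
    0 ∈ F ∧ (2 ^ k : ℝ) • X ∈ F := by
  have step : ∀ Y ∈ F, 0 ∈ F ∧ (2 : ℝ) • Y ∈ F := fun Y hY =>
    hF.2.2 0 PosSemidef.zero _ (smul_mem_psdCone (hF.1 hY) zero_le_two)
      (by rwa [zero_add, smul_smul, one_div, inv_mul_cancel₀ two_ne_zero, one_smul])
  refine ⟨(step X hX).1, ?_⟩
  induction k with
  | zero => simpa using hX
  | succ k ih => rw [pow_succ', mul_smul]; exact (step _ ih).2

/-- A face of the semidefinite cone is a cone, although this is not part of the definition. -/
theorem IsFace.smul_mem {F : Set (Matrix (Fin n) (Fin n) ℝ)} (hF : IsFace (psdCone n) F)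
    {X : Matrix (Fin n) (Fin n) ℝ} (hX : X ∈ F) {t : ℝ} (ht : 0 ≤ t) : t • X ∈ F := by
  obtain ⟨k, hk⟩ := pow_unbounded_of_one_lt t one_lt_two
  obtain ⟨h0, hkX⟩ := hF.two_pow_smul_mem hX k
  have h2 : (0 : ℝ) < 2 ^ k := by positivity
  have := hF.2.1.smul_mem_of_zero_mem h0 hkX (t := t / 2 ^ k)
    ⟨by positivity, (div_le_one h2).2 hk.le⟩
  rwa [smul_smul, div_mul_cancel₀ _ h2.ne'] at this

/-- The face property for sums instead of midpoints. -/
theorem IsFace.mem_of_add_mem {F : Set (Matrix (Fin n) (Fin n) ℝ)} (hF : IsFace (psdCone n) F)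
    {X Y : Matrix (Fin n) (Fin n) ℝ} (hX : X ∈ psdCone n) (hY : Y ∈ psdCone n)
    (h : X + Y ∈ F) : X ∈ F := by
  have h2 : (2 : ℝ) • X ∈ F := (hF.2.2 _ (smul_mem_psdCone hX zero_le_two) _
    (smul_mem_psdCone hY zero_le_two)
      (by rwa [← smul_add, smul_smul, one_div, inv_mul_cancel₀ two_ne_zero, one_smul])).1
  have := hF.smul_mem h2 (t := 1 / 2) (by norm_num)
  rwa [smul_smul, one_div, inv_mul_cancel₀ two_ne_zero, one_smul] at this

theorem isFace_minimalCone (H : Set (Matrix (Fin n) (Fin n) ℝ)) :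
    IsFace (psdCone n) (minimalCone H (psdCone n)) :=
  (isLeast_minimalCone H _ (convex_psdCone n)).1.1

theorem inter_subset_minimalCone (H : Set (Matrix (Fin n) (Fin n) ℝ)) :
    H ∩ psdCone n ⊆ minimalCone H (psdCone n) :=
  (isLeast_minimalCone H _ (convex_psdCone n)).1.2

/-- If `H` contains `1 + Y` with `Y` positive semidefinite, no facial reduction is needed. -/
theorem minimalCone_eq_psdCone {H : Set (Matrix (Fin n) (Fin n) ℝ)}
    {Y : Matrix (Fin n) (Fin n) ℝ} (hY : Y.PosSemidef) (hH : 1 + Y ∈ H) :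
    minimalCone H (psdCone n) = psdCone n := by
  have hF := isFace_minimalCone H
  refine hF.1.antisymm fun X hX => ?_
  obtain ⟨t, ht0, ht⟩ := exists_smul_one_sub_posSemidef (isSymm_of_posSemidef hX)
  refine hF.mem_of_add_mem hX (PosSemidef.add ht (smul_mem_psdCone hY ht0)) ?_
  have := hF.smul_mem (inter_subset_minimalCone H ⟨hH, PosSemidef.one.add hY⟩) ht0
  rwa [smul_add, ← add_sub_cancel X (t • 1), add_assoc] at this

theorem singularityDegree_eq_zero {H K : Set (Matrix (Fin n) (Fin n) ℝ)}
    (h : minimalCone H K = K) : singularityDegree H K = 0 :=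
  nonpos_iff_eq_zero.1 (sInf_le ⟨0, fun _ => 0, rfl, fun i hi => absurd hi i.not_lt_zero, h.symm⟩)

/-! ### Facial reduction -/

theorem isFace_reducedFace {H : Set (Matrix (Fin n) (Fin n) ℝ)} {k : ℕ}
    {y : ℕ → Matrix (Fin n) (Fin n) ℝ} (hy : IsFacialReduction H (psdCone n) k y) :
    IsFace (psdCone n) (reducedFace (psdCone n) y k) := by
  induction k with
  | zero => exact ⟨subset_rfl, convex_psdCone n, fun X hX Y hY _ => ⟨hX, hY⟩⟩
  | succ k ih =>
    obtain ⟨hsub, hconv, hface⟩ := ih fun i hi => hy i (hi.trans k.lt_succ_self)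
    refine ⟨fun X hX => hsub hX.1, fun X hX Y hY a b ha hb hab => ?_, fun X hX Y hY h => ?_⟩
    · refine ⟨hconv hX.1 hY.1 ha hb hab, ?_⟩
      rw [bullet_add, bullet_smul, bullet_smul, hX.2, hY.2]
      simp
    · obtain ⟨hX', hY'⟩ := hface X hX Y hY h.1
      have h1 := (hy k k.lt_succ_self).1.2 X hX'
      have h2 := (hy k k.lt_succ_self).1.2 Y hY'
      have h3 := h.2
      rw [bullet_smul, bullet_add] at h3
      exact ⟨⟨hX', by linarith⟩, ⟨hY', by linarith⟩⟩

theorem inter_subset_reducedFace {H : Set (Matrix (Fin n) (Fin n) ℝ)} {k : ℕ}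
    {y : ℕ → Matrix (Fin n) (Fin n) ℝ} (hy : IsFacialReduction H (psdCone n) k y) :
    H ∩ psdCone n ⊆ reducedFace (psdCone n) y k := by
  induction k with
  | zero => exact Set.inter_subset_right
  | succ k ih => exact fun X hX =>
      ⟨ih (fun i hi => hy i (hi.trans k.lt_succ_self)) hX, (hy k k.lt_succ_self).2.2 X hX.1⟩

theorem reducedFace_congr {K : Set (Matrix (Fin n) (Fin n) ℝ)} {k : ℕ}
    {y z : ℕ → Matrix (Fin n) (Fin n) ℝ} (h : ∀ i < k, y i = z i) :
    reducedFace K y k = reducedFace K z k := by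
  induction k with
  | zero => rfl
  | succ k ih =>
    simp only [reducedFace, ih fun i hi => h i (hi.trans k.lt_succ_self), h k k.lt_succ_self]

theorem IsFacialReduction.update {H K : Set (Matrix (Fin n) (Fin n) ℝ)} {k : ℕ}
    {y : ℕ → Matrix (Fin n) (Fin n) ℝ} (hy : IsFacialReduction H K k y)
    {Y : Matrix (Fin n) (Fin n) ℝ} (hY : Y ∈ dualCone (reducedFace K y k) ∩ perp H) :
    IsFacialReduction H K (k + 1) (Function.update y k Y) := by
  intro i hi
  have hc : reducedFace K (Function.update y k Y) i = reducedFace K y i :=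
    reducedFace_congr fun j hj => Function.update_of_ne (by omega) _ _
  rw [hc]
  rcases eq_or_ne i k with rfl | hik
  · rwa [Function.update_self]
  · rw [Function.update_of_ne hik]
    exact hy i (by omega)

theorem reducedFace_update {K : Set (Matrix (Fin n) (Fin n) ℝ)} {k : ℕ}
    {y : ℕ → Matrix (Fin n) (Fin n) ℝ} {Y : Matrix (Fin n) (Fin n) ℝ} :
    reducedFace K (Function.update y k Y) (k + 1) =
      {X | X ∈ reducedFace K y k ∧ bullet Y X = 0} := by
  have hc : reducedFace K (Function.update y k Y) k = reducedFace K y k :=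
    reducedFace_congr fun j hj => Function.update_of_ne (by omega) _ _
  simp only [reducedFace, hc, Function.update_self]

/-- Theorem of the alternative for a face `F` of the semidefinite cone: if `F` is not contained
in the minimal cone, then some combination of the matrices `G j` is nonnegative on `F` without
vanishing on it, so that a facial reduction step along it makes `F` smaller. -/
theorem exists_reducing_of_not_subset {G : ι → Matrix (Fin n) (Fin n) ℝ}
    {F : Set (Matrix (Fin n) (Fin n) ℝ)} (hF : IsFace (psdCone n) F)
    (h : ¬ F ⊆ minimalCone (orthSpace G) (psdCone n)) :
    ∃ w : ι → ℝ, (∀ X ∈ F, 0 ≤ w ⬝ᵥ pairing G X) ∧ ∃ X ∈ F, w ⬝ᵥ pairing G X ≠ 0 := by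
  classical
  by_contra! hno
  apply h
  intro X hX
  -- The image of `F` under the pairing is a cone; it is closed under negation, so `X` can be
  -- completed by some `Y` in `F` to a solution `X + Y` of the linear system.
  have hadd : ∀ X ∈ F, ∀ Y ∈ F, X + Y ∈ F := fun X hX Y hY => by
    have := hF.smul_mem (convex_iff_forall_pos.1 hF.2.1 hX hY one_half_pos one_half_pos
      (add_halves 1)) zero_le_two
    rwa [← smul_add, smul_smul, mul_one_div_cancel two_ne_zero, one_smul] at this
  let C : ConvexCone ℝ (ι → ℝ) := ConvexCone.map (pairing G)
    ⟨F, fun t ht X hX => hF.smul_mem hX ht.le, fun X hX Y hY => hadd X hX Y hY⟩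
  have hneg : -pairing G X ∈ C := by
    refine neg_mem_of_forall_dual_eq_zero_on C ?_ (fun f hf v hv => ?_) ⟨X, hX, rfl⟩
    · exact ⟨0, by simpa using hF.smul_mem hX le_rfl, map_zero _⟩
    · obtain ⟨Y, hY, rfl⟩ := hv
      rw [dual_apply_eq_dotProduct]
      refine hno _ (fun Z hZ => ?_) Y hY
      rw [← dual_apply_eq_dotProduct]
      exact hf _ ⟨Z, hZ, rfl⟩
  obtain ⟨Y, hY, hYX⟩ := hneg
  have hXY : pairing G (X + Y) = 0 := by
    rw [map_add, hYX, add_neg_cancel]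
  have hp := hF.1 (hadd X hX Y hY)
  exact (isFace_minimalCone _).mem_of_add_mem (hF.1 hX) (hF.1 hY)
    (inter_subset_minimalCone _ ⟨⟨isSymm_of_posSemidef hp, congrFun hXY⟩, hp⟩)

/-- The coefficient vectors of those combinations of the matrices `G j` that are orthogonal to
the set `F`. -/
def annihilator (G : ι → Matrix (Fin n) (Fin n) ℝ) (F : Set (Matrix (Fin n) (Fin n) ℝ)) :
    Submodule ℝ (ι → ℝ) where
  carrier := {w | ∀ X ∈ F, w ⬝ᵥ pairing G X = 0}
  add_mem' ha hb X hX := by rw [add_dotProduct, ha X hX, hb X hX, add_zero]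
  zero_mem' X _ := zero_dotProduct _
  smul_mem' t w hw X hX := by rw [smul_dotProduct, hw X hX, smul_zero]

theorem singularityDegree_le_of_reducedFace_subset {H : Set (Matrix (Fin n) (Fin n) ℝ)} {k : ℕ}
    {y : ℕ → Matrix (Fin n) (Fin n) ℝ} (hy : IsFacialReduction H (psdCone n) k y)
    (h : reducedFace (psdCone n) y k ⊆ minimalCone H (psdCone n)) :
    singularityDegree H (psdCone n) ≤ (k : ℕ∞) :=
  sInf_le ⟨k, y, rfl, hy, h.antisymm <| Set.sInter_subset_of_mem
    ⟨isFace_reducedFace hy, inter_subset_reducedFace hy⟩⟩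

/-- Each strict facial reduction step increases the dimension of the annihilator, which is at
most the number of equations. Hence the remaining number of steps is bounded by the codimension
of the annihilator of the current face. -/
theorem singularityDegree_le_add {G : ι → Matrix (Fin n) (Fin n) ℝ} (hG : ∀ j, (G j).IsSymm)
    (d k : ℕ) (y : ℕ → Matrix (Fin n) (Fin n) ℝ)
    (hy : IsFacialReduction (orthSpace G) (psdCone n) k y)
    (hd : Fintype.card ι ≤
      Module.finrank ℝ (annihilator G (reducedFace (psdCone n) y k)) + d) :
    singularityDegree (orthSpace G) (psdCone n) ≤ ((k + d : ℕ) : ℕ∞) := by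
  induction d generalizing k y with
  | zero =>
    have htop : annihilator G (reducedFace (psdCone n) y k) = ⊤ :=
      Submodule.eq_top_of_finrank_eq (le_antisymm (Submodule.finrank_le _) (by simpa using hd))
    have hsub : reducedFace (psdCone n) y k ⊆ minimalCone (orthSpace G) (psdCone n) := by
      by_contra h
      obtain ⟨w, -, X, hX, hne⟩ := exists_reducing_of_not_subset (isFace_reducedFace hy) h
      have hw : w ∈ annihilator G (reducedFace (psdCone n) y k) := htop ▸ Submodule.mem_top
      exact hne (hw X hX)
    exact singularityDegree_le_of_reducedFace_subset hy hsub
  | succ d ih =>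
    by_cases hsub : reducedFace (psdCone n) y k ⊆ minimalCone (orthSpace G) (psdCone n)
    · refine (singularityDegree_le_of_reducedFace_subset hy hsub).trans ?_
      exact_mod_cast Nat.le_add_right _ _
    · obtain ⟨w, hw, X, hX, hne⟩ := exists_reducing_of_not_subset (isFace_reducedFace hy) hsub
      have hY : ∑ j, w j • G j ∈ dualCone (reducedFace (psdCone n) y k) ∩ perp (orthSpace G) :=
        ⟨⟨isSymm_sum_smul hG w, fun Z hZ => by rw [bullet_sum_smul]; exact hw Z hZ⟩,
          sum_smul_mem_perp_orthSpace hG w⟩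
      have hlt : annihilator G (reducedFace (psdCone n) y k) <
          annihilator G
            (reducedFace (psdCone n) (Function.update y k (∑ j, w j • G j)) (k + 1)) := by
        rw [reducedFace_update]
        refine lt_of_le_of_ne (fun v hv Z hZ => hv Z hZ.1) fun heq => hne ?_
        have : w ∈ annihilator G (reducedFace (psdCone n) y k) := by
          rw [heq]
          exact fun Z hZ => by rw [← bullet_sum_smul]; exact hZ.2
        exact this X hX
      have := ih (k + 1) _ (hy.update hY)
        (by have := Submodule.finrank_lt_finrank_of_lt hlt; omega)
      rwa [show k + (d + 1) = k + 1 + d by omega]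

end SDPDuality

/-! ### The semidefinite program -/

namespace SDP
open SDPDuality
variable {m n : ℕ}

/-- The family `B, A₁, …, Aₘ`, indexed with `B` at `0`. -/
def pencil (S : SDP m n) : Fin (m + 1) → Matrix (Fin n) (Fin n) ℝ := Fin.cons S.B S.A

theorem sum_smul_pencil (S : SDP m n) (w : Fin (m + 1) → ℝ) :
    ∑ j, w j • S.pencil j = w 0 • S.B + ∑ i, w (Fin.succ i) • S.A i := by
  simp [pencil, Fin.sum_univ_succ]

theorem isSymm_pencil (S : SDP m n) (j : Fin (m + 1)) : (S.pencil j).IsSymm := by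
  refine Fin.cases ?_ (fun i => ?_) j
  · exact S.symm_B
  · exact S.symm_A i

theorem linHD_eq_orthSpace (S : SDP m n) : S.linHD = orthSpace S.pencil := by
  ext Y
  simp only [linHD, orthSpace, Set.mem_ofPred_eq, Fin.forall_fin_succ]
  exact and_congr_right fun _ => and_comm

/-- Since `B` has maximum rank among the slack matrices, its kernel is contained in the kernel of
every positive semidefinite combination of `B, A₁, …, Aₘ`: adding a multiple of `B` to the
combination and rescaling gives a slack matrix, whose kernel lies in that of `B` and is not
smaller. -/
theorem Standard.mulVec_eq_zero {S : SDP m n} (hS : S.Standard) {w : Fin (m + 1) → ℝ}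
    (hw : (∑ j, w j • S.pencil j).PosSemidef) {v : Fin n → ℝ} (hv : S.B *ᵥ v = 0) :
    (∑ j, w j • S.pencil j) *ᵥ v = 0 := by
  set Z := ∑ j, w j • S.pencil j with hZ
  have hB : S.B.PosSemidef := hS.isSlack_B.1
  have ht : 0 < |w 0| + 1 := by positivity
  have hs : 0 < w 0 + (|w 0| + 1) := by linarith [neg_abs_le (w 0)]
  set t := |w 0| + 1
  set s := w 0 + t with hs_def
  set N := s⁻¹ • (Z + t • S.B) with hN
  have hNpsd : N.PosSemidef := (hw.add (hB.smul ht.le)).smul (inv_pos.2 hs).le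
  have hslack : S.IsSlack N := by
    refine ⟨hNpsd, fun i => -(s⁻¹ * w i.succ), ?_⟩
    have h1 : s⁻¹ * w 0 + s⁻¹ * t = 1 := by rw [← mul_add, ← hs_def, inv_mul_cancel₀ hs.ne']
    have h2 : S.B = (s⁻¹ * w 0) • S.B + (s⁻¹ * t) • S.B := by rw [← add_smul, h1, one_smul]
    rw [hN, hZ, sum_smul_pencil]
    simp only [neg_smul, Finset.sum_neg_distrib, sub_neg_eq_add, smul_add, smul_smul,
      Finset.smul_sum]
    conv_rhs => rw [h2]
    abel
  have hle : LinearMap.ker N.mulVecLin ≤ LinearMap.ker S.B.mulVecLin := by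
    intro u hu
    simp only [LinearMap.mem_ker, mulVecLin_apply] at hu ⊢
    have hu' : (Z + t • S.B) *ᵥ u = 0 := by
      rw [hN, smul_mulVec] at hu
      exact (smul_eq_zero.1 hu).resolve_left (inv_pos.2 hs).ne'
    have h0 : u ⬝ᵥ Z *ᵥ u + t * (u ⬝ᵥ S.B *ᵥ u) = 0 := by
      rw [← smul_eq_mul, ← dotProduct_smul, ← smul_mulVec, ← dotProduct_add, ← add_mulVec, hu',
        dotProduct_zero]
    have hZu := hw.dotProduct_mulVec_nonneg u
    have hBu := hB.dotProduct_mulVec_nonneg u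
    rw [star_trivial] at hZu hBu
    refine (hB.dotProduct_mulVec_zero_iff u).1 ?_
    rw [star_trivial]
    refine le_antisymm (le_of_mul_le_mul_left (a := t) ?_ ht) hBu
    linarith
  have heq : LinearMap.ker N.mulVecLin = LinearMap.ker S.B.mulVecLin := by
    refine Submodule.eq_of_le_of_finrank_le hle ?_
    have h1 := N.mulVecLin.finrank_range_add_finrank_ker
    have h2 := S.B.mulVecLin.finrank_range_add_finrank_ker
    have h3 : Module.finrank ℝ (LinearMap.range N.mulVecLin) ≤
      Module.finrank ℝ (LinearMap.range S.B.mulVecLin) := hS.rank_le N hslack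
    omega
  have hvN : v ∈ LinearMap.ker N.mulVecLin := heq ▸ hv
  rw [LinearMap.mem_ker, mulVecLin_apply, hN, smul_mulVec] at hvN
  have := (smul_eq_zero.1 hvN).resolve_left (inv_pos.2 hs).ne'
  rwa [add_mulVec, smul_mulVec, hv, smul_zero, add_zero] at this

theorem Standard.bullet_eq_zero {S : SDP m n} (hS : S.Standard) {w : Fin (m + 1) → ℝ}
    (hw : (∑ j, w j • S.pencil j).PosSemidef) {X : Matrix (Fin n) (Fin n) ℝ}
    (hX : X.PosSemidef) (h : bullet S.B X = 0) : bullet (∑ j, w j • S.pencil j) X = 0 := by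
  have hBX := mul_eq_zero_of_bullet_eq_zero hS.isSlack_B.1 hX h
  have : (∑ j, w j • S.pencil j) * X = 0 := by
    ext i j
    have := hS.mulVec_eq_zero hw (v := X.col j) (funext fun i => congrFun (congrFun hBX i) j)
    exact congrFun this i
  rw [bullet, this, trace_zero]

/-- If `(HD)` has the largest possible singularity degree, then the only positive semidefinite
combinations of `B, A₁, …, Aₘ` are multiples of `B`. Otherwise the first reduction step, along
`B`, already makes two independent combinations vanish on the reduced face, which leaves at most
`m - 1` further steps. -/
theorem Standard.eq_zero_of_posSemidef {S : SDP m n} (hS : S.Standard)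
    (hd : S.singDegHD = (m : ℕ∞) + 1) {w : Fin (m + 1) → ℝ}
    (hw : (∑ j, w j • S.pencil j).PosSemidef) (i : Fin m) : w i.succ = 0 := by
  by_contra hi
  -- `w` and the coefficient vector of `B` span a plane inside the annihilator of the first face.
  have hB : S.B = ∑ j, (Pi.single 0 1 : Fin (m + 1) → ℝ) j • S.pencil j := by
    simp [pencil]
  have hy : IsFacialReduction (orthSpace S.pencil) (psdCone n) 1 fun _ => S.B := by
    intro k hk
    obtain rfl : k = 0 := by omega
    refine ⟨⟨S.symm_B, fun X hX => bullet_nonneg hS.isSlack_B.1 hX⟩, ?_⟩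
    have := sum_smul_mem_perp_orthSpace S.isSymm_pencil (Pi.single 0 1)
    rwa [← hB] at this
  set V := annihilator S.pencil (reducedFace (psdCone n) (fun _ => S.B) 1) with hV
  have hli : LinearIndependent ℝ ![(Pi.single 0 1 : Fin (m + 1) → ℝ), w] := by
    rw [LinearIndependent.pair_iff]
    intro a b hab
    have hb : b = 0 := by
      simpa [hi] using congrFun hab i.succ
    subst hb
    exact ⟨by simpa using congrFun hab 0, rfl⟩
  have hspan : Submodule.span ℝ (Set.range ![(Pi.single 0 1 : Fin (m + 1) → ℝ), w]) ≤ V := by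
    rw [Submodule.span_le]
    rintro _ ⟨k, rfl⟩
    fin_cases k
    · intro X hX
      rw [← bullet_sum_smul]
      change bullet (∑ j, (Pi.single 0 1 : Fin (m + 1) → ℝ) j • S.pencil j) X = 0
      rw [← hB]
      exact hX.2
    · intro X hX
      rw [← bullet_sum_smul]
      exact hS.bullet_eq_zero hw hX.1 hX.2
  have h2 : 2 ≤ Module.finrank ℝ V := by
    have := Submodule.finrank_mono hspan
    rwa [finrank_span_eq_card hli, Fintype.card_fin] at this
  have hm := i.pos
  have := singularityDegree_le_add S.isSymm_pencil (m - 1) 1 _ hy (by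
    rw [Fintype.card_fin, ← hV]
    omega)
  rw [← linHD_eq_orthSpace, ← singDegHD, hd] at this
  have h' : m + 1 ≤ 1 + (m - 1) := by exact_mod_cast this
  omega

theorem Standard.nonneg_of_posSemidef_smul {S : SDP m n} (hS : S.Standard) {t : ℝ}
    (ht : (t • S.B).PosSemidef) : 0 ≤ t := by
  have hB : S.B.PosSemidef := hS.isSlack_B.1
  by_contra! hneg
  have h1 := ht.trace_nonneg
  rw [trace_smul, smul_eq_mul] at h1
  have h0 : S.B.trace = 0 := le_antisymm (nonpos_of_mul_nonneg_right h1 hneg) hB.trace_nonneg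
  exact hS.linearIndependent.ne_zero 0 (hB.trace_eq_zero_iff.1 h0)

theorem Standard.feasP_eq {S : SDP m n} (hS : S.Standard) (hd : S.singDegHD = (m : ℕ∞) + 1) :
    S.feasP = {0} := by
  ext x
  constructor
  · intro hx
    have hw : (∑ j, (Fin.cons 1 (-x) : Fin (m + 1) → ℝ) j • S.pencil j).PosSemidef := by
      rw [sum_smul_pencil]
      simpa [feasP, sub_eq_add_neg] using hx
    ext i
    simpa using hS.eq_zero_of_posSemidef hd hw i
  · rintro rfl
    simpa [feasP] using hS.isSlack_B.1

/-- Strict feasibility of `(D)`, in the form `1 + Y` with `Y` positive semidefinite. The vectors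
`(Aᵢ • Y)ᵢ` with `Y` positive semidefinite form a cone that is all of `ℝᵐ`, as a functional
nonnegative on it is a positive semidefinite combination of `A₁, …, Aₘ`; so the cone contains
`c - (Aᵢ • 1)ᵢ`. -/
theorem Standard.exists_one_add_mem_feasD {S : SDP m n} (hS : S.Standard)
    (hd : S.singDegHD = (m : ℕ∞) + 1) :
    ∃ Y : Matrix (Fin n) (Fin n) ℝ, Y.PosSemidef ∧ 1 + Y ∈ S.feasD := by
  let C : ConvexCone ℝ (Fin m → ℝ) := ConvexCone.map (pairing S.A)
    ⟨psdCone n, fun t ht X hX => smul_mem_psdCone hX ht.le, fun X hX Y hY => PosSemidef.add hX hY⟩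
  have hC : C = ⊤ := by
    refine eq_top_of_forall_dual_eq_zero C ⟨0, PosSemidef.zero, map_zero _⟩ fun f hf => ?_
    set w : Fin m → ℝ := fun i => f (Pi.single i 1) with hw
    have hpsd : (∑ i, w i • S.A i).PosSemidef := by
      refine posSemidef_of_bullet_nonneg (isSymm_sum_smul S.symm_A w) fun Y hY => ?_
      rw [bullet_sum_smul, hw, ← dual_apply_eq_dotProduct]
      exact hf _ ⟨Y, hY, rfl⟩
    have hw0 : w = 0 := by
      ext i
      have := hS.eq_zero_of_posSemidef hd (w := Fin.cons 0 w)
        (by rw [sum_smul_pencil]; simpa using hpsd) i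
      simpa using this
    refine LinearMap.ext fun x => ?_
    rw [dual_apply_eq_dotProduct, ← hw, hw0, zero_dotProduct, LinearMap.zero_apply]
  have hmem : S.c - pairing S.A 1 ∈ C := hC ▸ Set.mem_univ _
  obtain ⟨Y, hY, hYc⟩ := hmem
  refine ⟨Y, hY, fun i => ?_, PosSemidef.one.add hY⟩
  rw [bullet_add]
  have := congrFun hYc i
  rw [Pi.sub_apply, pairing_apply, pairing_apply] at this
  linarith

/-- The infimum of `(D)` may fail to be attained. Solutions of small positive value are found by
showing that the cone of all `(B • Y - t ε, A₁ • Y - t c₁, …, Aₘ • Y - t cₘ)`, with `Y`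
positive semidefinite and `t ≥ 0`, is the whole space: it then contains `(-1, 0, …, 0)`. -/
theorem Standard.exists_feasD_lt {S : SDP m n} (hS : S.Standard)
    (hd : S.singDegHD = (m : ℕ∞) + 1) {ε : ℝ} (hε : 0 < ε) :
    ∃ Y ∈ S.feasD, bullet S.B Y < ε := by
  set p : Fin (m + 1) → ℝ := Fin.cons ε S.c with hp
  let C : ConvexCone ℝ (Fin (m + 1) → ℝ) := ConvexCone.map
    ((pairing S.pencil).coprod (LinearMap.toSpanSingleton ℝ (Fin (m + 1) → ℝ) (-p)))
    ⟨psdCone n ×ˢ Set.Ici 0,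
      fun r hr X hX => ⟨smul_mem_psdCone hX.1 hr.le, mul_nonneg hr.le hX.2⟩,
      fun X hX Y hY => ⟨PosSemidef.add hX.1 hY.1, show 0 ≤ X.2 + Y.2 from add_nonneg hX.2 hY.2⟩⟩
  have hmem : ∀ Y : Matrix (Fin n) (Fin n) ℝ, Y.PosSemidef → ∀ t : ℝ, 0 ≤ t →
      pairing S.pencil Y - t • p ∈ C := fun Y hY t ht =>
    ⟨(Y, t), ⟨hY, ht⟩, by simp [sub_eq_add_neg]⟩
  have hC : C = ⊤ := by
    refine eq_top_of_forall_dual_eq_zero C (by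
      have := hmem 0 PosSemidef.zero 0 le_rfl
      rwa [map_zero, zero_smul, sub_zero] at this) fun f hf => ?_
    set w : Fin (m + 1) → ℝ := fun i => f (Pi.single i 1) with hw
    have hfw : ∀ x, f x = w ⬝ᵥ x := dual_apply_eq_dotProduct f
    have hpsd : (∑ j, w j • S.pencil j).PosSemidef := by
      refine posSemidef_of_bullet_nonneg (isSymm_sum_smul S.isSymm_pencil w) fun Y hY => ?_
      have := hf _ (hmem Y hY 0 le_rfl)
      rwa [zero_smul, sub_zero, hfw, ← bullet_sum_smul] at this
    have hsucc := hS.eq_zero_of_posSemidef hd hpsd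
    have h0 : 0 ≤ w 0 := by
      refine hS.nonneg_of_posSemidef_smul ?_
      rw [sum_smul_pencil] at hpsd
      simpa [hsucc] using hpsd
    have h0' : w 0 * ε ≤ 0 := by
      have := hf _ (hmem 0 PosSemidef.zero 1 zero_le_one)
      rw [hfw] at this
      simpa [dotProduct, Fin.sum_univ_succ, hsucc, hp] using this
    have hw0 : w = 0 := by
      ext j
      refine Fin.cases ?_ hsucc j
      exact le_antisymm (nonpos_of_mul_nonpos_left h0' hε) h0
    refine LinearMap.ext fun x => ?_
    rw [hfw, hw0, zero_dotProduct, LinearMap.zero_apply]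
  have hneg : (Fin.cons (-1) 0 : Fin (m + 1) → ℝ) ∈ C := hC ▸ Set.mem_univ _
  obtain ⟨⟨Y, t⟩, ⟨hY, ht⟩, hYt⟩ := hneg
  have hB : bullet S.B Y - t * ε = -1 := by
    simpa [pairing_apply, pencil, hp, sub_eq_add_neg] using congrFun hYt 0
  have hA : ∀ i, bullet (S.A i) Y = t * S.c i := fun i => by
    have := congrFun hYt i.succ
    simp [pairing_apply, pencil, hp] at this
    linarith
  have hBY := bullet_nonneg hS.isSlack_B.1 hY
  have ht0 : 0 < t := pos_of_mul_pos_left (b := ε) (by linarith) hε.le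
  refine ⟨t⁻¹ • Y, ⟨fun i => ?_, smul_mem_psdCone hY (inv_pos.2 ht0).le⟩, ?_⟩
  · rw [bullet_smul, hA, inv_mul_cancel_left₀ ht0.ne']
  · rw [bullet_smul, inv_mul_lt_iff₀ ht0]
    linarith

theorem Standard.valD_eq_zero {S : SDP m n} (hS : S.Standard)
    (hd : S.singDegHD = (m : ℕ∞) + 1) : S.valD = 0 := by
  refine le_antisymm ?_ (le_iInf₂ fun Y hY =>
    EReal.coe_nonneg.2 (bullet_nonneg hS.isSlack_B.1 hY.2))
  refine EReal.le_of_forall_lt_iff_le.1 fun ε hε => ?_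
  obtain ⟨Y, hY, hlt⟩ := hS.exists_feasD_lt hd (EReal.coe_pos.1 hε)
  exact (iInf₂_le Y hY).trans (EReal.coe_le_coe_iff.2 hlt.le)

end SDP

open SDPDuality in
theorem mainTheorem2 {m n : ℕ} (S : SDP m n) (hS : S.Standard)
    (hd : S.singDegHD = (m : ℕ∞) + 1) :
    S.feasP = {0} ∧ S.StrictlyFeasibleD ∧ S.valP = 0 ∧ S.valD = 0 ∧ S.singDegD = 0 := by
  obtain ⟨Y, hY, hfeas⟩ := hS.exists_one_add_mem_feasD hd
  refine ⟨hS.feasP_eq hd, ⟨1 + Y, hfeas, PosDef.one.add_posSemidef hY⟩, ?_, hS.valD_eq_zero hd, ?_⟩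
  · simp [SDP.valP, hS.feasP_eq hd]
  · exact singularityDegree_eq_zero
      (minimalCone_eq_psdCone hY ⟨isSymm_of_posSemidef hfeas.2, hfeas.1⟩)
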